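/- Consider two qubits $A,B$ and the state $$\rho=\tfrac12|0\rangle\langle0|\otimes|+\rangle\langle+|+\tfrac12|+\rangle\langle+|\otimes|0\rangle\langle0|,\qquad |+\rangle=(|0\rangle+|1\rangle)/\sqrt2 .$$ A state is separable if it is a finite convex combination of products of density operators, and an unnormalized state is separable if it is a nonnegative multiple of a separable state; entangled means not separable. A two-qubit state is CQ if it has the form $\sum_i p_i|e_i\rangle\langle e_i|\otimes\rho_i$, and QC if it has the form $\sum_i p_i\,\rho_i\otimes|e_i\rangle\langle e_i|$, where $(e_i)$ is an orthonormal basis of $\mathbb C^2$, $(p_i)$ a probability distribution and the $\rho_i$ are density operators. It is QQ separable if it is separable and neither CQ nor QC. For a two-qubit state $\sigma$ and unitaries $U_A,U_B$ on $\mathbb C^2$ (the choice of control bases) let $$\tilde\sigma_{AB:A'B'}=V(\sigma\otimes|00\rangle\langle00|_{A'B'})V^\dagger,\qquad V=\mathrm{CNOT}_{A\to A'}\,\mathrm{CNOT}_{B\to B'}\,(U_A\otimes U_B\otimes I_{A'B'}),$$ and, for a vector $|\phi\rangle\in\mathbb C^2\otimes\mathbb C^2$, let $\tilde\sigma_{AB}(\phi)=\mathrm{Tr}_{A'B'}\big(\tilde\sigma_{AB:A'B'}\,(I\otimes|\phi\rangle\langle\phi|)\big)$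 be the (unnormalized) swapped state. Let $\circ$ denote the entrywise (Hadamard) product in the computational basis, and $|\phi^*\rangle$ the vector with complex conjugate coordinates in that basis. Then: 1. $\rho$ is QQ separable. 2. For all unitaries $U_A,U_B$, the state $\tilde\rho_{AB:A'B'}$ is entangled across the cut $AB:A'B'$. 3. For $U_A=U_B=I$ (the computational control basis), $\tilde\rho_{AB}(\phi)=\rho\circ|\phi^*\rangle\langle\phi^*|$ for every $|\phi\rangle$. 4. For every vector $|\phi\rangle\in\mathbb C^2\otimes\mathbb C^2$ (in particular every unit vector), $\rho\circ|\phi\rangle\langle\phi|$ has positive semidefinite partial transpose and is separable across $A:B$. Consequently there exist QQ separable two-qubit states $\sigma$ such that $\tilde\sigma_{AB:A'B'}$ is entangled across $AB:A'B'$ for all $U_A,U_B$, and yet for some choice of unitaries $U_A,U_B$ the swapped state $\tilde\sigma_{AB}(\phi)$ is separable across $A:B$ for every $|\phi\rangle$. -/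

import Mathlib

open scoped Matrix Kronecker ComplexOrder

noncomputable section

namespace ActivationSwap

/-- The operator `|v⟩⟨v|`, for a vector given by its coordinates in the computational basis. -/
def ketbra {ι : Type*} (v : ι → ℂ) : Matrix ι ι ℂ :=
  Matrix.vecMulVec v (star v)

/-- Density operators: positive semidefinite with trace one. -/
def IsDensity {ι : Type*} [Fintype ι] (ρ : Matrix ι ι ℂ) : Prop :=
  ρ.PosSemidef ∧ ρ.trace = 1

/-- Separable states across the cut between the two factors of the index set:
finite convex combinations of products of density operators. -/
def IsSeparableState {a b : Type*} [Fintype a] [Fintype b]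
    (ρ : Matrix (a × b) (a × b) ℂ) : Prop :=
  ∃ (n : ℕ) (p : Fin n → ℝ) (σ : Fin n → Matrix a a ℂ) (τ : Fin n → Matrix b b ℂ),
    (∀ i, 0 ≤ p i) ∧ ∑ i, p i = 1 ∧ (∀ i, IsDensity (σ i)) ∧ (∀ i, IsDensity (τ i)) ∧
      ρ = ∑ i, (p i : ℂ) • (σ i ⊗ₖ τ i)

/-- Separability of an unnormalized state: a nonnegative multiple of a separable state.
(For an operator of nonzero trace, this says that its normalization is a separable state.) -/
def IsSeparableUnnormalized {a b : Type*} [Fintype a] [Fintype b]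
    (X : Matrix (a × b) (a × b) ℂ) : Prop :=
  ∃ (c : ℝ) (σ : Matrix (a × b) (a × b) ℂ), 0 ≤ c ∧ IsSeparableState σ ∧ X = (c : ℂ) • σ

/-- Classical-quantum states `∑ᵢ pᵢ |eᵢ⟩⟨eᵢ| ⊗ ρᵢ`, with `(eᵢ)` an orthonormal basis of the
first system. -/
def IsCQ {a b : Type*} [Fintype a] [Fintype b] (ρ : Matrix (a × b) (a × b) ℂ) : Prop :=
  ∃ (e : OrthonormalBasis a ℂ (EuclideanSpace ℂ a)) (p : a → ℝ) (τ : a → Matrix b b ℂ),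
    (∀ i, 0 ≤ p i) ∧ ∑ i, p i = 1 ∧ (∀ i, IsDensity (τ i)) ∧
      ρ = ∑ i, (p i : ℂ) • (ketbra (e i).ofLp ⊗ₖ τ i)

/-- Quantum-classical states `∑ᵢ pᵢ ρᵢ ⊗ |eᵢ⟩⟨eᵢ|`, with `(eᵢ)` an orthonormal basis of the
second system. -/
def IsQC {a b : Type*} [Fintype a] [Fintype b] (ρ : Matrix (a × b) (a × b) ℂ) : Prop :=
  ∃ (e : OrthonormalBasis b ℂ (EuclideanSpace ℂ b)) (p : b → ℝ) (τ : b → Matrix a a ℂ),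
    (∀ i, 0 ≤ p i) ∧ ∑ i, p i = 1 ∧ (∀ i, IsDensity (τ i)) ∧
      ρ = ∑ i, (p i : ℂ) • (τ i ⊗ₖ ketbra (e i).ofLp)

/-- QQ separable states: separable states which are neither CQ nor QC. -/
def IsQQSeparable {a b : Type*} [Fintype a] [Fintype b]
    (ρ : Matrix (a × b) (a × b) ℂ) : Prop :=
  IsSeparableState ρ ∧ ¬ IsCQ ρ ∧ ¬ IsQC ρ

/-- Partial transpose on the second system. -/
def partialTranspose {a b : Type*} (X : Matrix (a × b) (a × b) ℂ) :
    Matrix (a × b) (a × b) ℂ :=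
  Matrix.of fun x y => X (x.1, y.2) (y.1, x.2)

/-- Partial trace over the second system. -/
def partialTraceRight {a b : Type*} [Fintype b] (X : Matrix (a × b) (a × b) ℂ) :
    Matrix a a ℂ :=
  Matrix.of fun i j => ∑ k, X (i, k) (j, k)

/-- The two-qubit CNOT `|j⟩|j'⟩ ↦ |j⟩|j' ⊕ j⟩`. The first qubit is the control. -/
def cnot : Matrix (Fin 2 × Fin 2) (Fin 2 × Fin 2) ℂ :=
  Matrix.of fun x y => if x = (y.1, y.2 + y.1) then 1 else 0

/-- The product of the CNOTs from `A` to `A'` and from `B` to `B'`, as an operator on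
`(A ⊗ B) ⊗ (A' ⊗ B')`. -/
def cnotAB :
    Matrix ((Fin 2 × Fin 2) × (Fin 2 × Fin 2)) ((Fin 2 × Fin 2) × (Fin 2 × Fin 2)) ℂ :=
  Matrix.of fun x y =>
    cnot (x.1.1, x.2.1) (y.1.1, y.2.1) * cnot (x.1.2, x.2.2) (y.1.2, y.2.2)

/-- The final state `V (ρ ⊗ |00⟩⟨00|) V†`, `V = CNOT · ((U_A ⊗ U_B) ⊗ I)`, of systems `AB`
and ancillae `A'B'` in the activation protocol. -/
def activatedState (UA UB : Matrix (Fin 2) (Fin 2) ℂ)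
    (ρ : Matrix (Fin 2 × Fin 2) (Fin 2 × Fin 2) ℂ) :
    Matrix ((Fin 2 × Fin 2) × (Fin 2 × Fin 2)) ((Fin 2 × Fin 2) × (Fin 2 × Fin 2)) ℂ :=
  (cnotAB * ((UA ⊗ₖ UB) ⊗ₖ 1)) * (ρ ⊗ₖ ketbra (Pi.single (0, 0) 1)) *
    (cnotAB * ((UA ⊗ₖ UB) ⊗ₖ 1))ᴴ

/-- The unnormalized state of the systems `AB` after the ancillae have been projected onto
`|φ⟩`: the partial trace over `A'B'` of the final state times `I ⊗ |φ⟩⟨φ|`. -/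
def swappedState (UA UB : Matrix (Fin 2) (Fin 2) ℂ)
    (ρ : Matrix (Fin 2 × Fin 2) (Fin 2 × Fin 2) ℂ) (φ : Fin 2 × Fin 2 → ℂ) :
    Matrix (Fin 2 × Fin 2) (Fin 2 × Fin 2) ℂ :=
  partialTraceRight (activatedState UA UB ρ * (1 ⊗ₖ ketbra φ))

/-- `|0⟩`. -/
def ket0 : Fin 2 → ℂ := ![1, 0]

/-- `|+⟩ = (|0⟩ + |1⟩) / √2`. -/
def ketPlus : Fin 2 → ℂ := ![1 / (√2 : ℝ), 1 / (√2 : ℝ)]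

/-- The state `½ |0⟩⟨0| ⊗ |+⟩⟨+| + ½ |+⟩⟨+| ⊗ |0⟩⟨0|`. -/
def qqState : Matrix (Fin 2 × Fin 2) (Fin 2 × Fin 2) ℂ :=
  (1 / 2 : ℂ) • (ketbra ket0 ⊗ₖ ketbra ketPlus) + (1 / 2 : ℂ) • (ketbra ketPlus ⊗ₖ ketbra ket0)

end ActivationSwap

end

open ActivationSwap

/-!
Why the activated entanglement of `qqState` is always present but cannot be swapped back.

*Presence.* Write `ρ' = (U_A ⊗ U_B) ρ (U_A ⊗ U_B)†`. The two CNOTs copy the computational basis,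
so the final state is `∑ ρ'_{xy} |x⟩⟨y| ⊗ |x⟩⟨y|` (`activatedState_apply`). Its partial transpose
has the entry `ρ'_{xy}` at position `((x, y), (y, x))`, while the diagonal entry at `(x, y)`
vanishes for `x ≠ y`. A separable state has positive semidefinite partial transpose, and a positive
semidefinite matrix with a zero on its diagonal vanishes on that row and column; hence separability
forces `ρ'` to be diagonal
(`apply_eq_zero_of_isSeparableState_activatedState`). Then `ρ` is a combination
`∑ Pᵢ ⊗ Tᵢ` with commuting `Pᵢ`.

*Commuting blocks.* In any sum `∑ Pᵢ ⊗ Tᵢ` with commuting `Pᵢ`, all the blocks `⟨b|ρ|b'⟩` commute.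
CQ states have this shape, as do QC states with the factors exchanged. The blocks `⟨0|ρ|0⟩` and
`⟨0|ρ|1⟩` of `qqState` do not commute (`qqState_ne_sum_kronecker`), which rules out
CQ states and a separable final state at once; QC states are ruled out as well, because `qqState` is
invariant under exchange of the two qubits.

*No swapping.* Both `|0⟩|+⟩` and `|+⟩|0⟩` remain product vectors when their coordinates are
multiplied by those of an arbitrary `φ`, because each is supported on two basis vectors that share
one of their labels. So `ρ ∘ |φ⟩⟨φ|` is a sum of two product operators.
-/

namespace ActivationSwap

/-! ### Separable operators -/

section Separable

variable {a b : Type*} [Fintype a] [Fintype b]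

theorem posSemidef_ketbra {ι : Type*} [Finite ι] (v : ι → ℂ) : (ketbra v).PosSemidef :=
  Matrix.posSemidef_vecMulVec_self_star v

theorem IsSeparableState.convex_comb {ρ σ : Matrix (a × b) (a × b) ℂ}
    (hρ : IsSeparableState ρ) (hσ : IsSeparableState σ) {s t : ℝ} (hs : 0 ≤ s) (ht : 0 ≤ t)
    (hst : s + t = 1) : IsSeparableState ((s : ℂ) • ρ + (t : ℂ) • σ) := by
  obtain ⟨n, p, α, β, hp, hp1, hα, hβ, rfl⟩ := hρ
  obtain ⟨m, q, γ, δ, hq, hq1, hγ, hδ, rfl⟩ := hσ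
  refine ⟨n + m, Fin.append (fun i => s * p i) (fun i => t * q i), Fin.append α γ,
    Fin.append β δ, ?_, ?_, ?_, ?_, ?_⟩
  · intro i
    refine Fin.addCases (fun i => ?_) (fun i => ?_) i
    · simpa using mul_nonneg hs (hp i)
    · simpa using mul_nonneg ht (hq i)
  · simp [Fin.sum_univ_add, ← Finset.mul_sum, hp1, hq1, hst]
  · intro i
    refine Fin.addCases (fun i => ?_) (fun i => ?_) i
    · simpa using hα i
    · simpa using hγ i
  · intro i
    refine Fin.addCases (fun i => ?_) (fun i => ?_) i
    · simpa using hβ i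
    · simpa using hδ i
  · simp [Fin.sum_univ_add, Finset.smul_sum, smul_smul]

theorem IsSeparableUnnormalized.add {X Y : Matrix (a × b) (a × b) ℂ}
    (hX : IsSeparableUnnormalized X) (hY : IsSeparableUnnormalized Y) :
    IsSeparableUnnormalized (X + Y) := by
  obtain ⟨c, ρ, hc, hρ, rfl⟩ := hX
  obtain ⟨d, σ, hd, hσ, rfl⟩ := hY
  obtain h | h := (add_nonneg hc hd).eq_or_lt
  · obtain rfl : c = 0 := by linarith
    obtain rfl : d = 0 := by linarith
    exact ⟨0, ρ, le_rfl, hρ, by simp⟩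
  · refine ⟨c + d, _, h.le, hρ.convex_comb hσ (s := c / (c + d)) (t := d / (c + d))
      (by positivity) (by positivity) (by field_simp), ?_⟩
    have h' : (c : ℂ) + d ≠ 0 := by exact_mod_cast h.ne'
    rw [smul_add, smul_smul, smul_smul]
    push_cast
    rw [mul_div_cancel₀ _ h', mul_div_cancel₀ _ h']

theorem IsSeparableUnnormalized.smul {X : Matrix (a × b) (a × b) ℂ}
    (hX : IsSeparableUnnormalized X) {r : ℝ} (hr : 0 ≤ r) :
    IsSeparableUnnormalized ((r : ℂ) • X) := by
  obtain ⟨c, ρ, hc, hρ, rfl⟩ := hX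
  exact ⟨r * c, ρ, mul_nonneg hr hc, hρ, by rw [smul_smul, Complex.ofReal_mul]⟩

theorem isSeparableState_kronecker {σ : Matrix a a ℂ} {τ : Matrix b b ℂ}
    (hσ : IsDensity σ) (hτ : IsDensity τ) : IsSeparableState (σ ⊗ₖ τ) :=
  ⟨1, fun _ => 1, fun _ => σ, fun _ => τ, fun _ => zero_le_one, by simp, fun _ => hσ,
    fun _ => hτ, by simp⟩

/-- A positive semidefinite operator is a nonnegative multiple of a density operator. The index set
has to be nonempty for density operators to exist at all, which matters for the zero operator. -/
theorem exists_isDensity_eq_smul [Nonempty a] {σ : Matrix a a ℂ} (hσ : σ.PosSemidef) :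
    ∃ (c : ℝ) (σ' : Matrix a a ℂ), 0 ≤ c ∧ IsDensity σ' ∧ σ = (c : ℂ) • σ' := by
  classical
  obtain ⟨c, hc, htr⟩ : ∃ c : ℝ, 0 ≤ c ∧ σ.trace = c := by
    have h := Complex.nonneg_iff.mp hσ.trace_nonneg
    exact ⟨σ.trace.re, h.1, Complex.ext rfl (by simp [← h.2])⟩
  obtain h | h := hc.eq_or_lt
  · have h0 : σ = 0 := hσ.trace_eq_zero_iff.mp (by simp [htr, ← h])
    refine ⟨0, ketbra (Pi.single (Classical.arbitrary a) 1), le_rfl,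
      ⟨posSemidef_ketbra _, ?_⟩, by simp [h0]⟩
    simp [ketbra, Matrix.trace_vecMulVec]
  · have h' : (c : ℂ) ≠ 0 := by exact_mod_cast h.ne'
    refine ⟨c, (c : ℂ)⁻¹ • σ, hc, ⟨hσ.smul ?_, ?_⟩, ?_⟩
    · rw [← Complex.ofReal_inv]
      exact_mod_cast inv_nonneg.mpr hc
    · rw [Matrix.trace_smul, htr, smul_eq_mul, inv_mul_cancel₀ h']
    · rw [smul_smul, mul_inv_cancel₀ h', one_smul]

theorem isSeparableUnnormalized_kronecker [Nonempty a] [Nonempty b] {σ : Matrix a a ℂ}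
    {τ : Matrix b b ℂ} (hσ : σ.PosSemidef) (hτ : τ.PosSemidef) :
    IsSeparableUnnormalized (σ ⊗ₖ τ) := by
  obtain ⟨c, σ', hc, hσ', rfl⟩ := exists_isDensity_eq_smul hσ
  obtain ⟨d, τ', hd, hτ', rfl⟩ := exists_isDensity_eq_smul hτ
  exact ⟨c * d, _, mul_nonneg hc hd, isSeparableState_kronecker hσ' hτ',
    by rw [Matrix.smul_kronecker, Matrix.kronecker_smul, smul_smul, Complex.ofReal_mul]⟩

/-! ### Positivity of the partial transpose -/

theorem IsSeparableState.posSemidef_partialTranspose {ρ : Matrix (a × b) (a × b) ℂ}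
    (hρ : IsSeparableState ρ) : (partialTranspose ρ).PosSemidef := by
  obtain ⟨n, p, σ, τ, hp, -, hσ, hτ, rfl⟩ := hρ
  have h : partialTranspose (∑ i, (p i : ℂ) • (σ i ⊗ₖ τ i)) =
      ∑ i, (p i : ℂ) • (σ i ⊗ₖ (τ i)ᵀ) := by
    ext x y
    simp [partialTranspose, Matrix.sum_apply]
  rw [h]
  refine Matrix.posSemidef_sum _ fun i _ => ?_
  exact ((hσ i).1.kronecker (hτ i).1.transpose).smul (by exact_mod_cast hp i)

theorem IsSeparableUnnormalized.posSemidef_partialTranspose {X : Matrix (a × b) (a × b) ℂ}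
    (hX : IsSeparableUnnormalized X) : (partialTranspose X).PosSemidef := by
  obtain ⟨c, σ, hc, hσ, rfl⟩ := hX
  exact hσ.posSemidef_partialTranspose.smul (a := (c : ℂ)) (by exact_mod_cast hc)

end Separable

theorem _root_.Matrix.PosSemidef.apply_eq_zero_of_diag_eq_zero {n : Type*} [Fintype n]
    {M : Matrix n n ℂ} (hM : M.PosSemidef) {i : n} (hi : M i i = 0) (j : n) : M j i = 0 := by
  classical
  have h := (hM.dotProduct_mulVec_zero_iff (Pi.single i 1)).mp (by simp [hi])
  simpa using congrFun h j

/-! ### Commuting blocks -/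

section Blocks

variable {ι a b : Type*} [Fintype ι] [Fintype a]

/-- The blocks `⟨k|ρ|l⟩` and `⟨m|ρ|n⟩` of `ρ = ∑ Pᵢ ⊗ Tᵢ` are combinations of the `Pᵢ`, so they
commute as soon as the `Pᵢ` do. -/
theorem commute_submatrix_sum_kronecker {P : ι → Matrix a a ℂ} (T : ι → Matrix b b ℂ)
    (hP : ∀ i j, Commute (P i) (P j)) (k l m n : b) :
    Commute ((∑ i, P i ⊗ₖ T i).submatrix (·, k) (·, l))
      ((∑ i, P i ⊗ₖ T i).submatrix (·, m) (·, n)) := by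
  have h : ∀ k l : b, (∑ i, P i ⊗ₖ T i).submatrix (·, k) (·, l) = ∑ i, T i k l • P i := by
    intro k l
    ext x y
    simp [Matrix.sum_apply, mul_comm]
  rw [h, h]
  exact .sum_left _ _ _ fun i _ => .sum_right _ _ _ fun j _ =>
    ((hP i j).smul_left _).smul_right _

theorem commute_ketbra_of_orthonormal [DecidableEq ι]
    (e : OrthonormalBasis ι ℂ (EuclideanSpace ℂ a)) (i j : ι) :
    Commute (ketbra (e i).ofLp) (ketbra (e j).ofLp) := by
  obtain rfl | hij := eq_or_ne i j
  · exact Commute.refl _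
  · have h : ∀ k l, k ≠ l → ketbra (e k).ofLp * ketbra (e l).ofLp = 0 := by
      intro k l hkl
      have h0 : inner ℂ (e k) (e l) = 0 := e.orthonormal.2 hkl
      rw [EuclideanSpace.inner_eq_star_dotProduct, dotProduct_comm] at h0
      rw [ketbra, ketbra, Matrix.vecMulVec_mul_vecMulVec, h0, zero_smul, Matrix.vecMulVec_zero]
    rw [Commute, SemiconjBy, h i j hij, h j i hij.symm]

end Blocks

theorem commute_conj_single {n : Type*} [Fintype n] [DecidableEq n] {U : Matrix n n ℂ}
    (hU : U ∈ Matrix.unitaryGroup n ℂ) (i j : n) :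
    Commute (Uᴴ * Matrix.single i i 1 * U) (Uᴴ * Matrix.single j j 1 * U) := by
  have hU' : U * Uᴴ = 1 := Matrix.mem_unitaryGroup_iff.mp hU
  have h : ∀ k l : n, (Uᴴ * Matrix.single k k 1 * U) * (Uᴴ * Matrix.single l l 1 * U) =
      Uᴴ * (Matrix.single k k 1 * Matrix.single l l 1) * U := by
    intro k l
    calc _ = Uᴴ * Matrix.single k k 1 * (U * Uᴴ) * Matrix.single l l 1 * U := by
          simp only [Matrix.mul_assoc]
      _ = _ := by rw [hU', Matrix.mul_one]; simp only [Matrix.mul_assoc]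
  rw [Commute, SemiconjBy, h, h]
  obtain rfl | hij := eq_or_ne i j
  · rfl
  · rw [Matrix.single_mul_single_of_ne _ _ _ _ hij, Matrix.single_mul_single_of_ne _ _ _ _ hij.symm]

/-- A matrix that local unitaries make diagonal is a sum `∑ Pᵢ ⊗ Tᵢ` with commuting `Pᵢ`. -/
theorem exists_eq_sum_kronecker_of_diagonal {a b : Type*} [Fintype a] [Fintype b] [DecidableEq a]
    [DecidableEq b] {U : Matrix a a ℂ} {V : Matrix b b ℂ} (hU : U ∈ Matrix.unitaryGroup a ℂ)
    (hV : V ∈ Matrix.unitaryGroup b ℂ) {ρ : Matrix (a × b) (a × b) ℂ} {d : a × b → ℂ}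
    (h : (U ⊗ₖ V) * ρ * (U ⊗ₖ V)ᴴ = Matrix.diagonal d) :
    ∃ (P : a → Matrix a a ℂ) (T : a → Matrix b b ℂ), (∀ i j, Commute (P i) (P j)) ∧
      ρ = ∑ i, P i ⊗ₖ T i := by
  have hW : (U ⊗ₖ V)ᴴ * (U ⊗ₖ V) = 1 :=
    Matrix.mem_unitaryGroup_iff'.mp (Matrix.kronecker_mem_unitary hU hV)
  have hρ : ρ = (U ⊗ₖ V)ᴴ * Matrix.diagonal d * (U ⊗ₖ V) := by
    calc ρ = ((U ⊗ₖ V)ᴴ * (U ⊗ₖ V)) * ρ * ((U ⊗ₖ V)ᴴ * (U ⊗ₖ V)) := by simp [hW]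
      _ = _ := by rw [← h]; simp only [Matrix.mul_assoc]
  have hd : Matrix.diagonal d =
      ∑ i, Matrix.single i i (1 : ℂ) ⊗ₖ Matrix.diagonal (fun j => d (i, j)) := by
    ext ⟨x, k⟩ ⟨y, l⟩
    simp only [Matrix.sum_apply, Matrix.kronecker_apply, Matrix.diagonal_apply,
      Matrix.single_apply, Prod.mk.injEq]
    rw [Finset.sum_eq_single x (fun i _ hi => by simp [hi]) (by simp)]
    by_cases hxy : x = y <;> by_cases hkl : k = l <;> simp [hxy, hkl]
  refine ⟨fun i => Uᴴ * Matrix.single i i 1 * U,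
    fun i => Vᴴ * Matrix.diagonal (fun j => d (i, j)) * V, commute_conj_single hU, ?_⟩
  rw [hρ, hd, Finset.mul_sum, Finset.sum_mul]
  simp only [Matrix.conjTranspose_kronecker, Matrix.mul_kronecker_mul]

/-! ### The activated state -/

theorem cnotAB_apply (x y : (Fin 2 × Fin 2) × (Fin 2 × Fin 2)) :
    cnotAB x y = if y = (x.1, x.2 - x.1) then 1 else 0 := by
  obtain ⟨⟨i, j⟩, k, l⟩ := x
  obtain ⟨⟨i', j'⟩, k', l'⟩ := y
  simp only [cnotAB, cnot, Matrix.of_apply, Prod.mk.injEq, Prod.mk_sub_mk, ← ite_and,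
    mul_ite, mul_one, mul_zero]
  congr 1
  rw [eq_iff_iff, eq_sub_iff_add_eq, eq_sub_iff_add_eq]
  constructor
  · rintro ⟨⟨rfl, rfl⟩, rfl, rfl⟩
    simp
  · rintro ⟨⟨rfl, rfl⟩, rfl, rfl⟩
    simp

/-- The final state is `∑ ρ'_{xy} |x⟩⟨y| ⊗ |x⟩⟨y|`, where `ρ'` is the rotated state. -/
theorem activatedState_apply (UA UB : Matrix (Fin 2) (Fin 2) ℂ)
    (ρ : Matrix (Fin 2 × Fin 2) (Fin 2 × Fin 2) ℂ) (x k y l : Fin 2 × Fin 2) :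
    activatedState UA UB ρ (x, k) (y, l) =
      if k = x ∧ l = y then ((UA ⊗ₖ UB) * ρ * (UA ⊗ₖ UB)ᴴ) x y else 0 := by
  have h : activatedState UA UB ρ =
      cnotAB * (((UA ⊗ₖ UB) * ρ * (UA ⊗ₖ UB)ᴴ) ⊗ₖ ketbra (Pi.single (0, 0) 1)) * cnotABᴴ := by
    have h1 : ((UA ⊗ₖ UB) * ρ * (UA ⊗ₖ UB)ᴴ) ⊗ₖ ketbra (Pi.single (0, 0) (1 : ℂ)) =
        ((UA ⊗ₖ UB) ⊗ₖ (1 : Matrix (Fin 2 × Fin 2) (Fin 2 × Fin 2) ℂ)) *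
          (ρ ⊗ₖ ketbra (Pi.single (0, 0) 1)) * ((UA ⊗ₖ UB) ⊗ₖ 1)ᴴ := by
      rw [Matrix.conjTranspose_kronecker _ (1 : Matrix (Fin 2 × Fin 2) (Fin 2 × Fin 2) ℂ),
        ← Matrix.mul_kronecker_mul, ← Matrix.mul_kronecker_mul]
      simp
    rw [h1, activatedState, Matrix.conjTranspose_mul]
    simp only [Matrix.mul_assoc]
  rw [h]
  generalize (UA ⊗ₖ UB) * ρ * (UA ⊗ₖ UB)ᴴ = ρ'
  simp only [Matrix.mul_apply (M := cnotAB * _), Matrix.mul_apply (M := cnotAB),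
    Matrix.conjTranspose_apply, cnotAB_apply, ite_mul, one_mul, zero_mul, Finset.sum_ite_eq',
    Finset.mem_univ, if_true, apply_ite star, star_one, star_zero, mul_ite, mul_one, mul_zero,
    Matrix.kronecker_apply, ketbra, Matrix.vecMulVec_apply, Pi.star_apply, Pi.single_apply]
  have h0 : ((0, 0) : Fin 2 × Fin 2) = 0 := rfl
  simp only [h0, sub_eq_zero, ← ite_and, and_comm]

/-- The partial transpose of the final state is zero at the diagonal position `(y, x)` and carries
`ρ'_{xy}` in the same column, so its positivity forces the rotated state `ρ'` to be diagonal. -/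
theorem apply_eq_zero_of_isSeparableState_activatedState {UA UB : Matrix (Fin 2) (Fin 2) ℂ}
    {ρ : Matrix (Fin 2 × Fin 2) (Fin 2 × Fin 2) ℂ}
    (h : IsSeparableState (activatedState UA UB ρ)) {x y : Fin 2 × Fin 2} (hxy : x ≠ y) :
    ((UA ⊗ₖ UB) * ρ * (UA ⊗ₖ UB)ᴴ) x y = 0 := by
  have h0 := h.posSemidef_partialTranspose.apply_eq_zero_of_diag_eq_zero (i := (y, x))
    (by simp [partialTranspose, activatedState_apply, hxy]) (x, y)
  simpa [partialTranspose, activatedState_apply] using h0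

theorem swappedState_one_one (ρ : Matrix (Fin 2 × Fin 2) (Fin 2 × Fin 2) ℂ)
    (φ : Fin 2 × Fin 2 → ℂ) :
    swappedState 1 1 ρ φ = Matrix.hadamard ρ (ketbra (star φ)) := by
  ext x y
  have h : ∀ k, (activatedState 1 1 ρ *
      ((1 : Matrix (Fin 2 × Fin 2) (Fin 2 × Fin 2) ℂ) ⊗ₖ ketbra φ)) (x, k) (y, k) =
      if k = x then ρ x y * (φ y * star (φ k)) else 0 := by
    intro k
    rw [Matrix.mul_apply, Finset.sum_eq_single (y, y)]
    · by_cases hk : k = x <;>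
        simp [activatedState_apply, hk, ketbra, Matrix.vecMulVec_apply]
    · rintro ⟨z, l⟩ - hz
      by_cases hzy : z = y
      · subst hzy
        have : l ≠ z := fun hl => hz (by rw [hl])
        simp [activatedState_apply, this]
      · simp [hzy]
    · simp
  simp only [swappedState, partialTraceRight, Matrix.of_apply, h, Finset.sum_ite_eq',
    Finset.mem_univ, if_true]
  simp [ketbra, Matrix.vecMulVec_apply, mul_comm]

/-! ### The state `qqState` -/

theorem ketbra_ketPlus : ketbra ketPlus = !![1 / 2, 1 / 2; 1 / 2, 1 / 2] := by
  have h : ((√2 : ℝ) : ℂ)⁻¹ * ((√2 : ℝ) : ℂ)⁻¹ = 2⁻¹ := by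
    rw [← mul_inv, ← Complex.ofReal_mul, Real.mul_self_sqrt zero_le_two]
    norm_num
  ext i j
  fin_cases i <;> fin_cases j <;> simp [ketbra, ketPlus, Matrix.vecMulVec_apply, h]

theorem ketbra_ket0 : ketbra ket0 = !![1, 0; 0, 0] := by
  ext i j
  fin_cases i <;> fin_cases j <;> simp [ketbra, ket0, Matrix.vecMulVec_apply]

theorem qqState_swap (x y : Fin 2 × Fin 2) : qqState x.swap y.swap = qqState x y := by
  simp only [qqState, Matrix.add_apply, Matrix.smul_apply, Matrix.kroneckerMap_apply, Prod.fst_swap,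
    Prod.snd_swap, smul_eq_mul]
  ring

/-- The blocks `⟨0|ρ|0⟩` and `⟨0|ρ|1⟩` of `qqState` do not commute. -/
theorem qqState_ne_sum_kronecker {ι : Type*} [Fintype ι] {P : ι → Matrix (Fin 2) (Fin 2) ℂ}
    (T : ι → Matrix (Fin 2) (Fin 2) ℂ) (hP : ∀ i j, Commute (P i) (P j)) :
    qqState ≠ ∑ i, P i ⊗ₖ T i := by
  intro h
  have hc := commute_submatrix_sum_kronecker T hP 0 0 0 1
  rw [← h] at hc
  have h01 := congrFun (congrFun hc.eq 0) 1
  simp [Matrix.mul_apply, qqState, ketbra_ketPlus, ketbra_ket0] at h01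

theorem not_isCQ_qqState : ¬ IsCQ qqState := by
  rintro ⟨e, p, τ, -, -, -, h⟩
  refine qqState_ne_sum_kronecker (fun i => (p i : ℂ) • τ i) (commute_ketbra_of_orthonormal e) ?_
  simpa only [Matrix.kronecker_smul] using h

theorem not_isQC_qqState : ¬ IsQC qqState := by
  rintro ⟨e, p, τ, -, -, -, h⟩
  refine qqState_ne_sum_kronecker (fun i => (p i : ℂ) • τ i) (commute_ketbra_of_orthonormal e) ?_
  ext x y
  rw [← qqState_swap, h]
  simp only [Matrix.sum_apply, Matrix.smul_apply, Matrix.kroneckerMap_apply, Prod.fst_swap,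
    Prod.snd_swap, smul_eq_mul]
  exact Finset.sum_congr rfl fun i _ => by ring

theorem isDensity_ketbra_ket0 : IsDensity (ketbra ket0) :=
  ⟨posSemidef_ketbra _, by simp [ketbra_ket0, Matrix.trace_fin_two]⟩

theorem isDensity_ketbra_ketPlus : IsDensity (ketbra ketPlus) :=
  ⟨posSemidef_ketbra _, by rw [ketbra_ketPlus, Matrix.trace_fin_two]; norm_num⟩

theorem isQQSeparable_qqState : IsQQSeparable qqState := by
  refine ⟨?_, not_isCQ_qqState, not_isQC_qqState⟩
  have h := (isSeparableState_kronecker isDensity_ketbra_ket0 isDensity_ketbra_ketPlus).convex_comb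
    (isSeparableState_kronecker isDensity_ketbra_ketPlus isDensity_ketbra_ket0)
    (s := 1 / 2) (t := 1 / 2) (by norm_num) (by norm_num) (by norm_num)
  simpa [qqState] using h

theorem not_isSeparableState_activatedState_qqState {UA UB : Matrix (Fin 2) (Fin 2) ℂ}
    (hA : UA ∈ Matrix.unitaryGroup (Fin 2) ℂ) (hB : UB ∈ Matrix.unitaryGroup (Fin 2) ℂ) :
    ¬ IsSeparableState (activatedState UA UB qqState) := by
  intro h
  have hd : ((UA ⊗ₖ UB) * qqState * (UA ⊗ₖ UB)ᴴ).IsDiag :=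
    fun _ _ hxy => apply_eq_zero_of_isSeparableState_activatedState h hxy
  obtain ⟨P, T, hP, hρ⟩ := exists_eq_sum_kronecker_of_diagonal hA hB hd.diagonal_diag.symm
  exact qqState_ne_sum_kronecker T hP hρ

/-- Multiplied entrywise by `φ`, the vectors `|0⟩|+⟩` and `|+⟩|0⟩` become
`|0⟩ ⊗ (φ₀₀|0⟩ + φ₀₁|1⟩) / √2` and `(φ₀₀|0⟩ + φ₁₀|1⟩) ⊗ |0⟩ / √2`; the factor `1/√2` of each,
together with the weight `½`, gives the coefficients `1/4`. -/
theorem hadamard_qqState (φ : Fin 2 × Fin 2 → ℂ) :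
    Matrix.hadamard qqState (ketbra φ) =
      ((1 / 4 : ℝ) : ℂ) • (ketbra ket0 ⊗ₖ ketbra fun j => φ (0, j)) +
        ((1 / 4 : ℝ) : ℂ) • ((ketbra fun i => φ (i, 0)) ⊗ₖ ketbra ket0) := by
  ext ⟨i, j⟩ ⟨k, l⟩
  simp only [qqState, ketbra_ketPlus, ketbra_ket0, Matrix.hadamard_apply, Matrix.add_apply,
    Matrix.smul_apply, Matrix.kroneckerMap_apply, smul_eq_mul]
  fin_cases i <;> fin_cases j <;> fin_cases k <;> fin_cases l <;>
    simp [ketbra, Matrix.vecMulVec_apply] <;> norm_num <;> ring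

theorem isSeparableUnnormalized_hadamard_qqState (φ : Fin 2 × Fin 2 → ℂ) :
    IsSeparableUnnormalized (Matrix.hadamard qqState (ketbra φ)) := by
  rw [hadamard_qqState]
  exact ((isSeparableUnnormalized_kronecker (posSemidef_ketbra _) (posSemidef_ketbra _)).smul
    (by norm_num)).add ((isSeparableUnnormalized_kronecker (posSemidef_ketbra _)
      (posSemidef_ketbra _)).smul (by norm_num))

end ActivationSwap

theorem mainTheorem4 :
    -- the state is QQ separable
    IsQQSeparable qqState ∧
    -- for all control bases, systems and ancillae are entangled after the activation protocol
    (∀ UA ∈ Matrix.unitaryGroup (Fin 2) ℂ, ∀ UB ∈ Matrix.unitaryGroup (Fin 2) ℂ,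
      ¬ IsSeparableState (activatedState UA UB qqState)) ∧
    -- in the computational control basis, the swapped state is a Hadamard product
    (∀ φ : Fin 2 × Fin 2 → ℂ,
      swappedState 1 1 qqState φ = Matrix.hadamard qqState (ketbra (star φ))) ∧
    -- this Hadamard product always has positive partial transpose and is separable
    (∀ φ : Fin 2 × Fin 2 → ℂ,
      (partialTranspose (Matrix.hadamard qqState (ketbra φ))).PosSemidef ∧
      IsSeparableUnnormalized (Matrix.hadamard qqState (ketbra φ))) ∧
    -- hence there are QQ separable states whose system-ancilla entanglement, though always
    -- created, cannot be swapped back into the systems for some choice of control bases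
    (∃ ρ : Matrix (Fin 2 × Fin 2) (Fin 2 × Fin 2) ℂ, IsQQSeparable ρ ∧
      (∀ UA ∈ Matrix.unitaryGroup (Fin 2) ℂ, ∀ UB ∈ Matrix.unitaryGroup (Fin 2) ℂ,
        ¬ IsSeparableState (activatedState UA UB ρ)) ∧
      ∃ UA ∈ Matrix.unitaryGroup (Fin 2) ℂ, ∃ UB ∈ Matrix.unitaryGroup (Fin 2) ℂ,
        ∀ φ : Fin 2 × Fin 2 → ℂ, IsSeparableUnnormalized (swappedState UA UB ρ φ)) := by
  have hqq : IsQQSeparable qqState := isQQSeparable_qqState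
  have hent : ∀ UA ∈ Matrix.unitaryGroup (Fin 2) ℂ, ∀ UB ∈ Matrix.unitaryGroup (Fin 2) ℂ,
      ¬ IsSeparableState (activatedState UA UB qqState) :=
    fun UA hA UB hB => not_isSeparableState_activatedState_qqState hA hB
  refine ⟨hqq, hent, swappedState_one_one qqState, fun φ => ?_, qqState, hqq, hent,
    1, one_mem _, 1, one_mem _, fun φ => ?_⟩
  · have h := isSeparableUnnormalized_hadamard_qqState φ
    exact ⟨h.posSemidef_partialTranspose, h⟩
  · rw [swappedState_one_one]
    exact isSeparableUnnormalized_hadamard_qqState (star φ)
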